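/- **Proposition (Albanese variety of a Bagnera–de Franchis variety).** Let $A_i=V_i/\Lambda_i$ ($i=1,2$) be complex Abelian varieties, with $V_i$ a finite-dimensional complex vector space and $\Lambda_i\subset V_i$ a lattice. Let $m\ge 2$, let $\beta_1\in A_1$ be an element of order exactly $m$, and let $\alpha_2\colon A_2\to A_2$ be a linear automorphism of order exactly $m$ that does not have $1$ as an eigenvalue (on $V_2$). Let $T_1\subset A_1$ and $T_2\subset A_2$ be finite subgroups and $T\subset A_1\times A_2$ the graph of an isomorphism $T_1\cong T_2$, such that $\alpha_2(t)=t$ for all $t\in T_2$ and $\langle\beta_1\rangle\cap T_1=\{0\}$. Put $A=(A_1\times A_2)/T$, let $G\cong\mathbb Z/m\mathbb Z$ be the group of automorphisms of $A$ generated by the automorphism $g$ induced by $(a_1,a_2)\mapsto(a_1+\beta_1,\alpha_2(a_2))$, which acts freely on $A$, and let $X=A/G$ be the corresponding Bagnera–de Franchis variety, a complex manifold. Let $$\operatorname{Alb}(X)=H^0(X,\Omega^1_X)^\vee/\operatorname{im}\bigl(H_1(X,\mathbb Z)\bigr)$$ be its Albanese variety, where $H_1(X,\mathbb Z)\to H^0(X,\Omega^1_X)^\vee$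 is given by integration of holomorphic one-forms along loops. Then $$\operatorname{Alb}(X)\;\cong\;A_1/(T_1+\langle\beta_1\rangle)$$ as complex tori, i.e. by a group isomorphism induced by a $\mathbb C$-linear isomorphism $V_1\cong H^0(X,\Omega^1_X)^\vee$. Moreover, for every base point $x_0\in X$, this isomorphism identifies the Albanese map $x\mapsto\bigl[\eta\mapsto\int_{x_0}^x\eta\bigr]$ of $X$ with the map $x\mapsto q(x)-q(x_0)$, where $q\colon X\to A_1/(T_1+\langle\beta_1\rangle)$ is the map induced by the first projection $A_1\times A_2\to A_1$. -/

import Mathlib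

open scoped Manifold ContDiff ComplexConjugate Topology
open Set

noncomputable section

/-! ### Complex manifolds: holomorphic one-forms, periods, the Albanese variety -/

section Albanese

variable (E X : Type*) [NormedAddCommGroup E] [NormedSpace ℂ E]
  [TopologicalSpace X] [ChartedSpace E X]

variable {X} in
/-- `γ`, restricted to `[0,1]`, is a continuously differentiable path in `X`. -/
def IsC1Path (γ : ℝ → X) : Prop :=
  ContMDiffOn 𝓘(ℝ, ℝ) 𝓘(ℝ, E) 1 γ (Icc 0 1)

variable [IsManifold 𝓘(ℂ, E) ω X]

/-- `H⁰(X, Ω¹_X)`: holomorphic sections of the holomorphic cotangent bundle of the complex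
manifold `X`, as a complex vector space. -/
abbrev HolomorphicOneForm : Type _ :=
  Cₛ^ω⟮𝓘(ℂ, E); E →L[ℂ] ℂ,
    fun x : X => TangentSpace 𝓘(ℂ, E) x →L[ℂ] Bundle.Trivial X ℂ x⟯

variable {E X}

/-- The integral `∫_γ η` of a holomorphic one-form along a path `γ : [0,1] → X`. -/
def HolomorphicOneForm.integral (η : HolomorphicOneForm E X) (γ : ℝ → X) : ℂ :=
  ∫ t in (0 : ℝ)..1,
    (η (γ t) : E →L[ℂ] ℂ) (mfderivWithin 𝓘(ℝ, ℝ) 𝓘(ℝ, E) γ (Icc 0 1) t (1 : ℝ) : E)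

variable (E X)

/-- The image of `H₁(X, ℤ)` in `H⁰(X, Ω¹_X)^∨` under `[γ] ↦ (η ↦ ∫_γ η)`: the subgroup generated
by the functionals "integration along a `C¹` loop". -/
def periodGroup : AddSubgroup (Module.Dual ℂ (HolomorphicOneForm E X)) :=
  AddSubgroup.closure
    {φ | ∃ γ : ℝ → X, IsC1Path E γ ∧ γ 0 = γ 1 ∧ ∀ η, φ η = η.integral γ}

/-- The Albanese variety `Alb(X) = H⁰(X, Ω¹_X)^∨ / im H₁(X, ℤ)`. -/
abbrev Albanese : Type _ :=
  Module.Dual ℂ (HolomorphicOneForm E X) ⧸ periodGroup E X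

variable {X}

/-- `a : X → Alb(X)` is the Albanese map with base point `x₀`: for every `C¹` path `γ` from `x₀`,
integration along `γ` is a linear functional on `H⁰(X, Ω¹_X)` and its class modulo periods is
`a (γ 1)`. -/
def IsAlbaneseMap (x₀ : X) (a : X → Albanese E X) : Prop :=
  ∀ γ : ℝ → X, IsC1Path E γ → γ 0 = x₀ →
    ∃ φ : Module.Dual ℂ (HolomorphicOneForm E X),
      (∀ η, φ η = η.integral γ) ∧ a (γ 1) = (φ : Albanese E X)

end Albanese

/-! ### Abelian varieties as polarized complex tori -/

section Torus

variable {V : Type*} [NormedAddCommGroup V] [NormedSpace ℂ V]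

/-- `V / L` is an Abelian variety: `L` is a lattice in the complex vector space `V`, and there is a
positive definite Hermitian form on `V` whose imaginary part is integral on `L`. -/
structure IsAbelianVariety (L : AddSubgroup V) : Prop where
  discrete : DiscreteTopology L
  span_eq_top : Submodule.span ℝ (L : Set V) = ⊤
  polarization : ∃ H : V →ₗ⋆[ℂ] V →ₗ[ℂ] ℂ,
    (∀ x y, H y x = conj (H x y)) ∧ (∀ x, x ≠ 0 → 0 < (H x x).re) ∧
    ∀ x ∈ L, ∀ y ∈ L, ∃ n : ℤ, (H x y).im = n

/-- The automorphism of the torus `V / L` induced by a linear automorphism of `V` preserving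
`L`. -/
def torusAut (L : AddSubgroup V) (α : V ≃L[ℂ] V)
    (h : L.map (α.toLinearEquiv.toAddEquiv : V →+ V) = L) : V ⧸ L ≃+ V ⧸ L :=
  QuotientAddGroup.congr L L α.toLinearEquiv.toAddEquiv h

end Torus

/-! ### Bagnera–de Franchis varieties -/

variable (V₁ V₂ : Type*) [NormedAddCommGroup V₁] [NormedSpace ℂ V₁]
  [NormedAddCommGroup V₂] [NormedSpace ℂ V₂]

/-- The data presenting a Bagnera–de Franchis variety `X = A / G`, `A = (A₁ × A₂) / T`, where
`Aᵢ = Vᵢ / Λᵢ`. -/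
structure BagneraDeFranchis where
  Λ₁ : AddSubgroup V₁
  Λ₂ : AddSubgroup V₂
  abelian₁ : IsAbelianVariety Λ₁
  abelian₂ : IsAbelianVariety Λ₂
  /-- the order of the cyclic group `G` -/
  m : ℕ
  one_lt_m : 1 < m
  /-- the translation part -/
  β₁ : V₁ ⧸ Λ₁
  order_β₁ : addOrderOf β₁ = m
  /-- the linear part -/
  α₂ : V₂ ≃L[ℂ] V₂
  map_α₂ : Λ₂.map (α₂.toLinearEquiv.toAddEquiv : V₂ →+ V₂) = Λ₂
  order_α₂ : orderOf α₂ = m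
  no_eigenvalue_one : ¬ Module.End.HasEigenvalue (α₂.toLinearEquiv : V₂ →ₗ[ℂ] V₂) 1
  T₁ : AddSubgroup (V₁ ⧸ Λ₁)
  T₂ : AddSubgroup (V₂ ⧸ Λ₂)
  finite_T₁ : Finite T₁
  /-- the isomorphism whose graph is `T` -/
  ψ : T₁ ≃+ T₂
  fix_T₂ : ∀ t ∈ T₂, torusAut Λ₂ α₂ map_α₂ t = t
  disjoint_β₁ : Disjoint (AddSubgroup.zmultiples β₁) T₁

namespace BagneraDeFranchis

variable {V₁ V₂}
variable (D : BagneraDeFranchis V₁ V₂)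

abbrev A₁ : Type _ := V₁ ⧸ D.Λ₁

abbrev A₂ : Type _ := V₂ ⧸ D.Λ₂

/-- The finite subgroup `T ⊆ A₁ × A₂`, the graph of `ψ : T₁ ≃ T₂`. -/
def T : AddSubgroup (D.A₁ × D.A₂) :=
  (D.T₁.subtype.prod (D.T₂.subtype.comp D.ψ.toAddMonoidHom)).range

/-- `A = (A₁ × A₂) / T`. -/
abbrev A : Type _ := (D.A₁ × D.A₂) ⧸ D.T

/-- `α₂` as an automorphism of `A₂`. -/
def α₂bar : D.A₂ ≃+ D.A₂ := torusAut D.Λ₂ D.α₂ D.map_α₂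

lemma map_T : D.T.map (((AddEquiv.refl D.A₁).prodCongr D.α₂bar : _ ≃+ _) :
    D.A₁ × D.A₂ →+ D.A₁ × D.A₂) = D.T := by
  have key : ∀ x ∈ D.T, ((AddEquiv.refl D.A₁).prodCongr D.α₂bar) x = x := by
    rintro _ ⟨t, rfl⟩
    exact Prod.ext rfl (D.fix_T₂ _ (D.ψ t).2)
  ext x
  constructor
  · rintro ⟨y, hy, rfl⟩
    have := key y hy
    simp only [AddMonoidHom.coe_coe]
    rw [this]; exact hy
  · intro hx
    exact ⟨x, hx, key x hx⟩

/-- The generator `g` of `G`: the automorphism of `A` induced by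
`(a₁, a₂) ↦ (a₁ + β₁, α₂ a₂)`. -/
def g : Equiv.Perm D.A :=
  (QuotientAddGroup.congr D.T D.T ((AddEquiv.refl D.A₁).prodCongr D.α₂bar) D.map_T).toEquiv.trans
    (Equiv.addRight (((D.β₁, 0) : D.A₁ × D.A₂) : D.A))

lemma g_mk (a₁ : D.A₁) (a₂ : D.A₂) :
    D.g (((a₁, a₂) : D.A₁ × D.A₂) : D.A) = (((a₁ + D.β₁, D.α₂bar a₂) : D.A₁ × D.A₂) : D.A) := by
  change (((a₁ + D.β₁, D.α₂bar a₂ + 0) : D.A₁ × D.A₂) : D.A) = _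
  rw [add_zero]

/-- The cyclic group `G = ⟨g⟩` of automorphisms of `A`. -/
def G : Subgroup (Equiv.Perm D.A) := Subgroup.zpowers D.g

/-- The Bagnera–de Franchis variety `X = A / G`, with the quotient topology. -/
def X : Type _ := MulAction.orbitRel.Quotient D.G D.A

instance : TopologicalSpace D.X :=
  inferInstanceAs (TopologicalSpace (MulAction.orbitRel.Quotient D.G D.A))

/-- The projection `V₁ × V₂ → A`. -/
def toA : V₁ × V₂ →+ D.A :=
  (QuotientAddGroup.mk' D.T).comp
    ((QuotientAddGroup.mk' D.Λ₁).prodMap (QuotientAddGroup.mk' D.Λ₂))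

/-- The projection `A → X`. -/
def mkX (a : D.A) : D.X := Quotient.mk (MulAction.orbitRel D.G D.A) a

/-- The universal covering `V₁ × V₂ → X`. -/
def p (v : V₁ × V₂) : D.X := D.mkX (D.toA v)

lemma g_toA (b : V₁) (hb : (b : D.A₁) = D.β₁) (v : V₁ × V₂) :
    D.g (D.toA v) = D.toA (v.1 + b, D.α₂ v.2) := by
  change D.g ((((v.1 : D.A₁), (v.2 : D.A₂)) : D.A₁ × D.A₂) : D.A) = _
  rw [g_mk, ← hb]
  rfl

lemma g_pow_mk (k : ℕ) (a₁ : D.A₁) (a₂ : D.A₂) :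
    (D.g ^ k) (((a₁, a₂) : D.A₁ × D.A₂) : D.A) =
      (((a₁ + k • D.β₁, D.α₂bar^[k] a₂) : D.A₁ × D.A₂) : D.A) := by
  induction k with
  | zero => simp
  | succ k ih =>
    rw [pow_succ', Equiv.Perm.mul_apply, ih, g_mk, Function.iterate_succ_apply', succ_nsmul,
      add_assoc]

lemma α₂bar_iterate (k : ℕ) (v : V₂) : D.α₂bar^[k] (v : D.A₂) = ((D.α₂ ^ k) v : V₂) := by
  induction k with
  | zero => rfl
  | succ k ih =>
    rw [Function.iterate_succ_apply', ih, pow_succ']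
    rfl

lemma g_pow_m : D.g ^ D.m = 1 := by
  ext a
  induction a using QuotientAddGroup.induction_on with
  | H x =>
    obtain ⟨a₁, a₂⟩ := x
    induction a₂ using QuotientAddGroup.induction_on with
    | H v =>
      rw [g_pow_mk, α₂bar_iterate, ← D.order_β₁, addOrderOf_nsmul_eq_zero, D.order_β₁,
        ← D.order_α₂, pow_orderOf_eq_one, add_zero]
      rfl

lemma isOfFinOrder_g : IsOfFinOrder D.g :=
  isOfFinOrder_iff_pow_eq_one.mpr ⟨D.m, by have := D.one_lt_m; omega, D.g_pow_m⟩

instance : Finite D.G := by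
  have : Finite (Subgroup.zpowers D.g) := finite_zpowers.mpr D.isOfFinOrder_g
  exact this

lemma exists_pow_of_mem_G {h : Equiv.Perm D.A} (hh : h ∈ D.G) : ∃ k : ℕ, h = D.g ^ k := by
  have := (D.isOfFinOrder_g.mem_powers_iff_mem_zpowers).mpr hh
  obtain ⟨k, hk⟩ := this
  exact ⟨k, hk.symm⟩

/-- The action of `G` on `A` is free. -/
lemma free_G (h : D.G) (a : D.A) (ha : h • a = a) : h = 1 := by
  obtain ⟨h, hh⟩ := h
  obtain ⟨k, rfl⟩ := D.exists_pow_of_mem_G hh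
  replace ha : (D.g ^ k) a = a := ha
  apply Subtype.ext
  change D.g ^ k = 1
  induction a using QuotientAddGroup.induction_on with
  | H x =>
    obtain ⟨a₁, a₂⟩ := x
    rw [g_pow_mk, eq_comm, QuotientAddGroup.eq] at ha
    obtain ⟨t, ht⟩ := ha
    have h1 : (t : D.A₁) = k • D.β₁ := by
      have := congrArg Prod.fst ht
      simpa using this
    have h2 : k • D.β₁ = 0 :=
      (AddSubgroup.disjoint_def.mp D.disjoint_β₁)
        (AddSubgroup.nsmul_mem _ (AddSubgroup.mem_zmultiples _) k) (h1 ▸ t.2)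
    obtain ⟨j, rfl⟩ := D.order_β₁ ▸ addOrderOf_dvd_of_nsmul_eq_zero h2
    rw [pow_mul, g_pow_m, one_pow]

instance : IsCancelSMul D.G D.A :=
  isCancelSMul_iff_eq_one_of_smul_eq.mpr D.free_G

instance : DiscreteTopology D.Λ₁ := D.abelian₁.discrete

instance : DiscreteTopology D.Λ₂ := D.abelian₂.discrete

instance : Finite D.T₁ := D.finite_T₁

instance : Finite D.T := by
  have : Finite (D.T₁.subtype.prod (D.T₂.subtype.comp D.ψ.toAddMonoidHom)).range :=
    Set.finite_range _
  exact this

instance : IsClosed (D.Λ₁ : Set V₁) := AddSubgroup.isClosed_of_discrete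

instance : IsClosed (D.Λ₂ : Set V₂) := AddSubgroup.isClosed_of_discrete

instance : IsClosed (D.T : Set (D.A₁ × D.A₂)) := (Set.finite_range _).isClosed

lemma continuous_g : Continuous D.g := by
  have h2 : Continuous D.α₂bar :=
    QuotientAddGroup.isOpenQuotientMap_mk.continuous_comp_iff.mp
      (QuotientAddGroup.continuous_mk.comp D.α₂.continuous)
  refine QuotientAddGroup.isOpenQuotientMap_mk.continuous_comp_iff.mp ?_
  have : D.g ∘ ((↑) : D.A₁ × D.A₂ → D.A) =
      fun x => (((x.1 + D.β₁, D.α₂bar x.2) : D.A₁ × D.A₂) : D.A) := by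
    funext x
    exact D.g_mk x.1 x.2
  rw [this]
  exact QuotientAddGroup.continuous_mk.comp (by fun_prop)

instance : ContinuousConstSMul D.G D.A where
  continuous_const_smul := by
    rintro ⟨h, hh⟩
    obtain ⟨k, rfl⟩ := D.exists_pow_of_mem_G hh
    change Continuous (⇑(D.g ^ k))
    rw [Equiv.Perm.coe_pow]
    exact D.continuous_g.iterate k

lemma isLocalHomeomorph_toA : IsLocalHomeomorph D.toA := by
  have h1 : IsLocalHomeomorph ((↑) : V₁ → D.A₁) :=
    (AddSubgroup.isAddQuotientCoveringMap_of_comm D.Λ₁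
      ⟨D.abelian₁.discrete⟩).isCoveringMap.isLocalHomeomorph
  have h2 : IsLocalHomeomorph ((↑) : V₂ → D.A₂) :=
    (AddSubgroup.isAddQuotientCoveringMap_of_comm D.Λ₂
      ⟨D.abelian₂.discrete⟩).isCoveringMap.isLocalHomeomorph
  have h3 : IsLocalHomeomorph ((↑) : D.A₁ × D.A₂ → D.A) :=
    (AddSubgroup.isAddQuotientCoveringMap_of_comm D.T
      (Set.finite_range _).isDiscrete).isCoveringMap.isLocalHomeomorph
  have h4 : IsLocalHomeomorph (Prod.map ((↑) : V₁ → D.A₁) ((↑) : V₂ → D.A₂)) := by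
    refine IsLocalHomeomorph.mk _ fun x => ?_
    obtain ⟨e, he, hee⟩ := h1 x.1
    obtain ⟨f, hf, hff⟩ := h2 x.2
    refine ⟨e.prod f, ⟨he, hf⟩, ?_⟩
    intro y _
    rw [hee, hff]
    rfl
  exact h3.comp h4

lemma surjective_toA : Function.Surjective D.toA := by
  intro a
  induction a using QuotientAddGroup.induction_on with
  | H x =>
    obtain ⟨a₁, a₂⟩ := x
    induction a₁ using QuotientAddGroup.induction_on with
    | H v =>
      induction a₂ using QuotientAddGroup.induction_on with
      | H w => exact ⟨(v, w), rfl⟩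

lemma surjective_p : Function.Surjective D.p :=
  Quotient.mk_surjective.comp D.surjective_toA

/-- Points of `V₁ × V₂` over the same point of `X` are related by an affine deck
transformation. -/
lemma exists_deck {v w : V₁ × V₂} (h : D.p v = D.p w) :
    ∃ φ : V₁ × V₂ → V₁ × V₂, ContDiff ℂ ω φ ∧ φ v = w ∧ ∀ u, D.p (φ u) = D.p u := by
  obtain ⟨⟨s, hs⟩, hsv⟩ := (Quotient.eq''.mp h.symm : D.toA w ∈ MulAction.orbit D.G (D.toA v))
  obtain ⟨k, rfl⟩ := D.exists_pow_of_mem_G hs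
  replace hsv : (D.g ^ k) (D.toA v) = D.toA w := hsv
  obtain ⟨b, hb⟩ := QuotientAddGroup.mk_surjective D.β₁
  let γ : V₁ × V₂ → V₁ × V₂ := fun v => (v.1 + b, D.α₂ v.2)
  have hγ : ContDiff ℂ ω γ :=
    (contDiff_fst.add contDiff_const).prodMk (D.α₂.contDiff.comp contDiff_snd)
  have hγk : ContDiff ℂ ω γ^[k] := by
    clear hsv hs
    induction k with
    | zero => exact contDiff_id
    | succ k ih => rw [Function.iterate_succ']; exact hγ.comp ih
  have hA : ∀ u, D.toA (γ^[k] u) = (D.g ^ k) (D.toA u) := by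
    clear hsv hs hγk
    intro u
    induction k with
    | zero => simp
    | succ k ih =>
      rw [Function.iterate_succ_apply', pow_succ', Equiv.Perm.mul_apply, ← ih, D.g_toA b hb]
  have hc : D.toA (w - γ^[k] v) = 0 := by rw [map_sub, hA, hsv, sub_self]
  refine ⟨fun u => γ^[k] u + (w - γ^[k] v), hγk.add contDiff_const, by simp, fun u => ?_⟩
  unfold p
  rw [map_add, hc, add_zero, hA]
  exact Quotient.sound (s := MulAction.orbitRel D.G D.A) ⟨⟨D.g ^ k, hs⟩, rfl⟩

/-- The quotient group `A₁ / (T₁ + ⟨β₁⟩)`. -/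
abbrev B : Type _ := D.A₁ ⧸ (D.T₁ ⊔ AddSubgroup.zmultiples D.β₁)

/-- The homomorphism `A → A₁ / (T₁ + ⟨β₁⟩)` induced by the first projection. -/
def AtoB : D.A →+ D.B :=
  QuotientAddGroup.lift D.T ((QuotientAddGroup.mk' _).comp (AddMonoidHom.fst D.A₁ D.A₂)) (by
    rintro _ ⟨t, rfl⟩
    exact (QuotientAddGroup.eq_zero_iff _).mpr (AddSubgroup.mem_sup_left t.2))

lemma AtoB_g (a : D.A) : D.AtoB (D.g a) = D.AtoB a := by
  induction a using QuotientAddGroup.induction_on with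
  | H x =>
    obtain ⟨a₁, a₂⟩ := x
    rw [g_mk]
    change ((a₁ + D.β₁ : D.A₁) : D.B) = ((a₁ : D.A₁) : D.B)
    rw [QuotientAddGroup.mk_add, add_eq_left]
    exact (QuotientAddGroup.eq_zero_iff _).mpr
      (AddSubgroup.mem_sup_right (AddSubgroup.mem_zmultiples _))

/-- The map `X → A₁ / (T₁ + ⟨β₁⟩)` induced by the first projection `A₁ × A₂ → A₁`. -/
def XtoB : D.X → D.B :=
  Quotient.lift D.AtoB (by
    rintro _ b ⟨⟨s, hs⟩, rfl⟩
    obtain ⟨k, rfl⟩ := D.exists_pow_of_mem_G hs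
    change D.AtoB ((D.g ^ k) b) = D.AtoB b
    clear hs
    induction k with
    | zero => simp
    | succ k ih => rw [pow_succ', Equiv.Perm.mul_apply, AtoB_g, ih])

lemma contDiffOn_transition (e e' : OpenPartialHomeomorph D.X (V₁ × V₂))
    (he : ∀ v, e.symm v = D.p v) (he' : ∀ v, e'.symm v = D.p v) :
    ContDiffOn ℂ ω (e' ∘ e.symm) (e.symm ≫ₕ e').source := by
  intro v hv
  have hv1 : v ∈ e.target := by simpa using hv.1
  have hv2 : e.symm v ∈ e'.source := hv.2
  obtain ⟨φ, hφ, hφv, hφp⟩ := D.exists_deck (v := v) (w := e' (e.symm v))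
    (by rw [← he' (e' _), e'.left_inv hv2, he])
  have h1 : ∀ᶠ u in 𝓝 v, φ u ∈ e'.target :=
    hφ.continuous.continuousAt.eventually_mem
      (by rw [hφv]; exact e'.open_target.mem_nhds (e'.map_source hv2))
  have h2 : e' ∘ e.symm =ᶠ[𝓝 v] φ := by
    filter_upwards [h1] with u hu
    rw [Function.comp_apply, he, ← hφp u, ← he' (φ u), e'.right_inv hu]
  exact (hφ.contDiffAt.congr_of_eventuallyEq h2).contDiffWithinAt

variable [FiniteDimensional ℂ V₁] [FiniteDimensional ℂ V₂]

lemma isLocalHomeomorph_p : IsLocalHomeomorph D.p := by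
  have := FiniteDimensional.proper ℂ V₁
  have := FiniteDimensional.proper ℂ V₂
  have h : IsLocalHomeomorph D.mkX :=
    (isQuotientCoveringMap_quotientMk_of_properlyDiscontinuousSMul
      (G := D.G) (E := D.A)).isCoveringMap.isLocalHomeomorph
  exact h.comp D.isLocalHomeomorph_toA

/-- The complex structure on `X`: the charts are the local inverses of `V₁ × V₂ → X`. -/
instance : ChartedSpace (V₁ × V₂) D.X :=
  letI := chartedSpaceSelf (V₁ × V₂)
  D.isLocalHomeomorph_p.chartedSpace D.surjective_p

instance : IsManifold 𝓘(ℂ, V₁ × V₂) ω D.X := by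
  refine isManifold_of_contDiffOn _ _ _ ?_
  rintro _ _ ⟨x, rfl⟩ ⟨y, rfl⟩
  have key : ∀ z, ∀ v, ((D.isLocalHomeomorph_p.localInverseAt z).trans
      (chartAt (V₁ × V₂) z)).symm v = D.p v := by
    intro z v
    simp [chartAt_self_eq]
  have := D.contDiffOn_transition _ _ (key (D.surjective_p.hasRightInverse.choose x))
    (key (D.surjective_p.hasRightInverse.choose y))
  refine this.mono ?_
  intro v hv
  exact hv.1

end BagneraDeFranchis

end

/-! Pull a holomorphic one-form on `X` back along the covering `p : V₁ × V₂ → X`. Its coefficients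
are holomorphic and periodic under `Λ₁ × Λ₂`, so by Liouville they are constant (`pullback_eq`). The
lift `(v₁, v₂) ↦ (v₁ + b, α₂ v₂)` of `g` preserves this constant covector, which therefore vanishes
on the image of `α₂ - 1`, and that image is all of `V₂` (`pullback_apply_snd`). Conversely, deck
transformations translate the first coordinate, so every linear form on `V₁` descends to `X`
(`constForm`). Thus the one-forms are the dual of `V₁`, and their dual is `V₁` (`dualEquiv`).

Under this identification, integration along `γ` is evaluation at the vector obtained by integrating
the `V₁`-velocity of `γ` (`integral_eq`). The image of that vector in `A₁ / (T₁ + ⟨β₁⟩)` is `q (γ 1)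
- q (γ 0)`, where `q` is `XtoB` (`toB_integral_velocity`). So loops give vectors in the kernel of
`toB`. Conversely, each vector of the kernel is the period of the image of a segment
(`exists_p_eq_p_zero`). The two quotients of `V₁` therefore have the same kernel, and the same
displacement formula identifies the Albanese map. -/

/-- A holomorphic function on a complex vector space that is periodic with respect to a lattice
defining an Abelian variety is constant. -/
lemma IsAbelianVariety.apply_eq_of_periodic {V F : Type*} [NormedAddCommGroup V] [NormedSpace ℂ V]
    [FiniteDimensional ℂ V] [NormedAddCommGroup F] [NormedSpace ℂ F]
    {L : AddSubgroup V} (hL : IsAbelianVariety L) {f : V → F} (hf : Differentiable ℂ f)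
    (hper : ∀ z, ∀ w ∈ L, f (z + w) = f z) (x y : V) : f x = f y := by
  have : FiniteDimensional ℝ V := FiniteDimensional.complexToReal V
  have : DiscreteTopology (AddSubgroup.toIntSubmodule L) := hL.discrete
  have : IsZLattice ℝ (AddSubgroup.toIntSubmodule L) := ⟨hL.span_eq_top⟩
  exact hf.apply_eq_apply_of_bounded
    (IsZLattice.isCompact_range_of_periodic (AddSubgroup.toIntSubmodule L) f hf.continuous
      hper).isBounded x y

/-! ### Deck transformations, and the kernel of `V₁ → A₁ / (T₁ + ⟨β₁⟩)` -/

namespace BagneraDeFranchis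

variable {V₁ V₂ : Type*} [NormedAddCommGroup V₁] [NormedSpace ℂ V₁]
  [NormedAddCommGroup V₂] [NormedSpace ℂ V₂] (D : BagneraDeFranchis V₁ V₂)

lemma p_translate {b : V₁} (hb : (b : D.A₁) = D.β₁) (u : V₁ × V₂) :
    D.p (u.1 + b, D.α₂ u.2) = D.p u := by
  unfold p
  rw [← D.g_toA b hb]
  exact Quotient.sound (s := MulAction.orbitRel D.G D.A)
    ⟨⟨D.g, Subgroup.mem_zpowers _⟩, rfl⟩

lemma p_add_of_toA_eq_zero {w : V₁ × V₂} (hw : D.toA w = 0) (u : V₁ × V₂) :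
    D.p (u + w) = D.p u := by
  unfold p
  rw [map_add, hw, add_zero]

lemma toA_eq_zero_of_mem {w : V₁ × V₂} (h₁ : w.1 ∈ D.Λ₁) (h₂ : w.2 ∈ D.Λ₂) : D.toA w = 0 := by
  change ((((w.1 : D.A₁), (w.2 : D.A₂)) : D.A₁ × D.A₂) : D.A) = 0
  rw [(QuotientAddGroup.eq_zero_iff _).mpr h₁, (QuotientAddGroup.eq_zero_iff _).mpr h₂]
  rfl

lemma XtoB_p (v : V₁ × V₂) : D.XtoB (D.p v) = ((v.1 : D.A₁) : D.B) := rfl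

/-- Points of `V₁ × V₂` over the same point of `X` are related by a holomorphic deck
transformation which acts on the first coordinate by a translation. -/
lemma exists_deck_translation {v w : V₁ × V₂} (h : D.p v = D.p w) :
    ∃ φ : V₁ × V₂ → V₁ × V₂, ContDiff ℂ ω φ ∧ φ v = w ∧ (∀ u, D.p (φ u) = D.p u) ∧
      ∀ u, (φ u).1 = u.1 + (w.1 - v.1) := by
  obtain ⟨⟨s, hs⟩, hsv⟩ := (Quotient.eq''.mp h.symm : D.toA w ∈ MulAction.orbit D.G (D.toA v))
  obtain ⟨k, rfl⟩ := D.exists_pow_of_mem_G hs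
  replace hsv : (D.g ^ k) (D.toA v) = D.toA w := hsv
  obtain ⟨b, hb⟩ := QuotientAddGroup.mk_surjective D.β₁
  let γ : V₁ × V₂ → V₁ × V₂ := fun v => (v.1 + b, D.α₂ v.2)
  have hγ : ContDiff ℂ ω γ :=
    (contDiff_fst.add contDiff_const).prodMk (D.α₂.contDiff.comp contDiff_snd)
  have key : ContDiff ℂ ω γ^[k] ∧ ∀ u, D.toA (γ^[k] u) = (D.g ^ k) (D.toA u) ∧
      D.p (γ^[k] u) = D.p u ∧ (γ^[k] u).1 = u.1 + k • b := by
    clear hsv hs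
    induction k with
    | zero => exact ⟨contDiff_id, fun u => by simp⟩
    | succ k ih =>
      refine ⟨by rw [Function.iterate_succ']; exact hγ.comp ih.1, fun u => ?_⟩
      obtain ⟨h1, h2, h3⟩ := ih.2 u
      rw [Function.iterate_succ_apply', pow_succ', Equiv.Perm.mul_apply, ← h1, D.g_toA b hb]
      refine ⟨rfl, (D.p_translate hb _).trans h2, ?_⟩
      change (γ^[k] u).1 + b = _
      rw [h3, succ_nsmul, add_assoc]
  obtain ⟨hγk, key⟩ := key
  -- The equality `hsv` holds only in `A`, so `γ^[k] v` and `w` may differ by an element of the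
  -- kernel of `toA`. Translating by it corrects the map without changing its image in `X`.
  have hc : D.toA (w - γ^[k] v) = 0 := by rw [map_sub, (key v).1, hsv, sub_self]
  refine ⟨fun u => γ^[k] u + (w - γ^[k] v), hγk.add contDiff_const, by simp, fun u => ?_,
    fun u => ?_⟩
  · rw [D.p_add_of_toA_eq_zero hc, (key u).2.1]
  · simp only [Prod.fst_add, Prod.fst_sub, (key _).2.2]
    abel

/-- The projection `V₁ → A₁ / (T₁ + ⟨β₁⟩)`. -/
def toB : V₁ →+ D.B := (QuotientAddGroup.mk' _).comp (QuotientAddGroup.mk' D.Λ₁)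

lemma toB_surjective : Function.Surjective D.toB :=
  (QuotientAddGroup.mk'_surjective _).comp (QuotientAddGroup.mk'_surjective _)

/-- Modulo `Λ₁`, `v` is `t + k • β₁` with `t ∈ T₁`. Taking `w` over `ψ t` makes the class of `(v,
w)` differ from `g ^ k` applied to `0` by an element of the graph `T`. This closes up segments into
loops in `X`. -/
lemma exists_p_eq_p_zero {v : V₁} (hv : D.toB v = 0) : ∃ w : V₂, D.p (v, w) = D.p 0 := by
  obtain ⟨t, ht, z, hz, htz⟩ := AddSubgroup.mem_sup.mp ((QuotientAddGroup.eq_zero_iff _).mp hv)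
  have hfin : IsOfFinAddOrder D.β₁ := by
    rw [← addOrderOf_pos_iff, D.order_β₁]
    exact zero_lt_one.trans D.one_lt_m
  obtain ⟨k, hk⟩ := (hfin.mem_multiples_iff_mem_zmultiples).mpr hz
  obtain ⟨w, hw⟩ := QuotientAddGroup.mk_surjective (D.ψ ⟨t, ht⟩ : D.A₂)
  refine ⟨w, Quotient.sound (s := MulAction.orbitRel D.G D.A)
    ⟨⟨D.g ^ k, Subgroup.npow_mem_zpowers _ _⟩, ?_⟩⟩
  change (D.g ^ k) ((((0 : V₁) : D.A₁), ((0 : V₂) : D.A₂)) : D.A₁ × D.A₂) =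
    ((((v : D.A₁), (w : D.A₂)) : D.A₁ × D.A₂) : D.A)
  rw [g_pow_mk, α₂bar_iterate, map_zero, QuotientAddGroup.eq]
  refine ⟨⟨t, ht⟩, ?_⟩
  refine Prod.ext ?_ ?_
  · change t = -(((0 : V₁) : D.A₁) + k • D.β₁) + (v : D.A₁)
    have hv' : (v : D.A₁) = t + z := htz.symm
    have hk' : k • D.β₁ = z := hk
    rw [hv', hk', QuotientAddGroup.mk_zero]
    abel
  · change (D.ψ ⟨t, ht⟩ : D.A₂) = -((0 : V₂) : D.A₂) + (w : D.A₂)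
    rw [hw, QuotientAddGroup.mk_zero, neg_zero, zero_add]

/-- Absence of the eigenvalue `1` makes `α₂ - 1` injective, hence onto in finite dimension. -/
lemma surjective_α₂_sub_id [FiniteDimensional ℂ V₂] :
    Function.Surjective (fun v : V₂ => D.α₂ v - v) := by
  let f : V₂ →ₗ[ℂ] V₂ := (D.α₂.toLinearEquiv : V₂ →ₗ[ℂ] V₂) - LinearMap.id
  have hf : Function.Injective f := by
    rw [injective_iff_map_eq_zero]
    intro v hv
    by_contra hne
    refine D.no_eigenvalue_one (Module.End.hasEigenvalue_of_hasEigenvector (x := v) ⟨?_, hne⟩)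
    rw [Module.End.mem_eigenspace_iff, one_smul]
    exact sub_eq_zero.mp hv
  exact LinearMap.injective_iff_surjective.mp hf

/-! ### The covering `V₁ × V₂ → X` in charts -/

variable [FiniteDimensional ℂ V₁] [FiniteDimensional ℂ V₂]

lemma chartAt_symm_apply (x : D.X) (v : V₁ × V₂) :
    (chartAt (V₁ × V₂) x).symm v = D.p v := by
  change ((D.isLocalHomeomorph_p.localInverseAt _).trans
      (@chartAt _ _ _ _ (chartedSpaceSelf (V₁ × V₂)) _)).symm v = D.p v
  simp [chartAt_self_eq]

lemma p_chartAt {x y : D.X} (hy : y ∈ (chartAt (V₁ × V₂) x).source) :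
    D.p (chartAt (V₁ × V₂) x y) = y := by
  rw [← D.chartAt_symm_apply x, (chartAt (V₁ × V₂) x).left_inv hy]

lemma continuous_p : Continuous D.p := D.isLocalHomeomorph_p.continuous

/-- In a chart, the covering `V₁ × V₂ → X` is locally a holomorphic map which acts on the first
coordinate by a translation. -/
lemma chartAt_comp_p {x : D.X} {v : V₁ × V₂} (hv : D.p v ∈ (chartAt (V₁ × V₂) x).source) :
    ∃ φ : V₁ × V₂ → V₁ × V₂, ∃ c : V₁, ContDiff ℂ ω φ ∧ (∀ u, (φ u).1 = u.1 + c) ∧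
      chartAt (V₁ × V₂) x ∘ D.p =ᶠ[𝓝 v] φ := by
  obtain ⟨φ, hφ, hφv, hφp, hφ1⟩ := D.exists_deck_translation (D.p_chartAt hv).symm
  refine ⟨φ, _, hφ, hφ1, ?_⟩
  have h1 : ∀ᶠ u in 𝓝 v, φ u ∈ (chartAt (V₁ × V₂) x).target :=
    hφ.continuous.continuousAt.eventually_mem
      (by rw [hφv]; exact (chartAt (V₁ × V₂) x).open_target.mem_nhds
            ((chartAt (V₁ × V₂) x).map_source hv))
  filter_upwards [h1] with u hu
  rw [Function.comp_apply, ← hφp u, ← D.chartAt_symm_apply x, OpenPartialHomeomorph.right_inv _ hu]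

lemma contMDiff_p : ContMDiff 𝓘(ℂ, V₁ × V₂) 𝓘(ℂ, V₁ × V₂) ω D.p := by
  intro v
  rw [contMDiffAt_iff_target]
  refine ⟨D.continuous_p.continuousAt, ?_⟩
  obtain ⟨φ, c, hφ, -, h⟩ := D.chartAt_comp_p (mem_chart_source (V₁ × V₂) (D.p v))
  exact (hφ.contDiffAt.congr_of_eventuallyEq h).contMDiffAt

/-- The derivative of the covering `V₁ × V₂ → X` at `v`, in the preferred chart at `p v`. -/
noncomputable def derivP (v : V₁ × V₂) : V₁ × V₂ →L[ℂ] V₁ × V₂ :=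
  mfderiv 𝓘(ℂ, V₁ × V₂) 𝓘(ℂ, V₁ × V₂) D.p v

lemma derivP_of_eventuallyEq {v : V₁ × V₂} {φ : V₁ × V₂ → V₁ × V₂}
    (h : chartAt (V₁ × V₂) (D.p v) ∘ D.p =ᶠ[𝓝 v] φ) :
    D.derivP v = fderiv ℂ φ v := by
  unfold derivP
  rw [(D.contMDiff_p.mdifferentiableAt (by simp)).mfderiv]
  simp only [writtenInExtChartAt, mfld_simps, fderivWithin_univ]
  exact h.fderiv_eq

end BagneraDeFranchis

/-! ### Velocities and displacements of paths, through local lifts -/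

section TranslationCovering

variable {E W X : Type*} [NormedAddCommGroup E] [NormedSpace ℂ E]
  [NormedAddCommGroup W] [NormedSpace ℂ W] [TopologicalSpace X] [ChartedSpace E X]

/-- `p : E → X` is inverse to all preferred charts of `X`, and in every chart it is locally a
holomorphic map over a translation of `W`, with respect to the linear map `π : E → W`. -/
structure IsTranslationCovering (π : E →L[ℂ] W) (p : E → X) : Prop where
  continuous : Continuous p
  chartAt_symm_apply : ∀ x v, (chartAt E x).symm v = p v
  chartAt_comp : ∀ x v, p v ∈ (chartAt E x).source → ∃ φ : E → E, ∃ c : W, ContDiff ℂ ω φ ∧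
    (∀ u, π (φ u) = π u + c) ∧ chartAt E x ∘ p =ᶠ[𝓝 v] φ

namespace IsTranslationCovering

variable {π : E →L[ℂ] W} {p : E → X} {γ : ℝ → X} {u : ℝ → E} {s : Set ℝ} {t : ℝ}

lemma apply_chartAt (hp : IsTranslationCovering π p) {x y : X} (hy : y ∈ (chartAt E x).source) :
    p (chartAt E x y) = y := by
  rw [← hp.chartAt_symm_apply x, (chartAt E x).left_inv hy]

/-- A path that is locally of the form `p ∘ u` is, in a chart, locally of the form `φ ∘ u`. -/
lemma exists_chartAt_comp_path (hp : IsTranslationCovering π p)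
    {x : X} (hγ : γ =ᶠ[𝓝[s] t] p ∘ u) (ht : γ t = p (u t))
    (hu : ContinuousWithinAt u s t) (hx : γ t ∈ (chartAt E x).source) :
    ∃ φ : E → E, ∃ c : W, ContDiff ℂ ω φ ∧ (∀ v, π (φ v) = π v + c) ∧
      chartAt E x ∘ γ =ᶠ[𝓝[s] t] φ ∘ u ∧ chartAt E x (γ t) = φ (u t) := by
  obtain ⟨φ, c, hφ, hc, h⟩ := hp.chartAt_comp x (u t) (ht ▸ hx)
  refine ⟨φ, c, hφ, hc, ?_, by rw [ht]; exact h.self_of_nhds⟩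
  filter_upwards [hγ, hu.eventually h] with r h1 h2
  rw [Function.comp_apply, h1]
  exact h2

lemma chartAt_comp_contDiffWithinAt (hp : IsTranslationCovering π p) {x : X}
    (hγ : ContMDiffWithinAt 𝓘(ℝ, ℝ) 𝓘(ℝ, E) 1 γ s t) (hx : γ t ∈ (chartAt E x).source) :
    ContDiffWithinAt ℝ 1 (chartAt E x ∘ γ) s t := by
  rw [contMDiffWithinAt_iff_target] at hγ
  have hu : ContDiffWithinAt ℝ 1 (chartAt E (γ t) ∘ γ) s t := hγ.2.contDiffWithinAt
  have h1 : γ =ᶠ[𝓝[s] t] p ∘ (chartAt E (γ t) ∘ γ) := by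
    filter_upwards [hγ.1.eventually_mem (chart_source_mem_nhds E (γ t))] with r hr
    exact (hp.apply_chartAt hr).symm
  obtain ⟨φ, c, hφ, -, h, h'⟩ := hp.exists_chartAt_comp_path h1
    (hp.apply_chartAt (mem_chart_source E (γ t))).symm hu.continuousWithinAt hx
  exact (((hφ.restrict_scalars ℝ).of_le le_top).contDiffAt.comp_contDiffWithinAt _
    hu).congr_of_eventuallyEq h h'

lemma contMDiffWithinAt_comp (hp : IsTranslationCovering π p)
    {n : WithTop ℕ∞} (hu : ContDiffWithinAt ℝ n u s t) :
    ContMDiffWithinAt 𝓘(ℝ, ℝ) 𝓘(ℝ, E) n (p ∘ u) s t := by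
  rw [contMDiffWithinAt_iff_target]
  refine ⟨hp.continuous.continuousAt.comp_continuousWithinAt hu.continuousWithinAt, ?_⟩
  obtain ⟨φ, c, hφ, -, h, h'⟩ := hp.exists_chartAt_comp_path (γ := p ∘ u) (.refl _ _) rfl
    hu.continuousWithinAt (mem_chart_source E _)
  exact ((((hφ.restrict_scalars ℝ).of_le le_top).contDiffAt.comp_contDiffWithinAt _
    hu).congr_of_eventuallyEq h h').contMDiffWithinAt

/-- The velocity depends on the preferred chart at `γ t`, but its image under `π` does not: chart
and lift differ by a map that is a translation after `π`, and the constant disappears on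
differentiation. -/
lemma map_mfderivWithin (hp : IsTranslationCovering π p)
    (hγ : γ =ᶠ[𝓝[s] t] p ∘ u) (ht : γ t = p (u t))
    (hu : DifferentiableWithinAt ℝ u s t) (hs : UniqueDiffWithinAt ℝ s t) :
    π (mfderivWithin 𝓘(ℝ, ℝ) 𝓘(ℝ, E) γ s t (1 : ℝ) : E) = derivWithin (π ∘ u) s t := by
  obtain ⟨φ, c, hφ, hc, h, h'⟩ := hp.exists_chartAt_comp_path hγ ht hu.continuousWithinAt
    (mem_chart_source E (γ t))
  have hcont : ContinuousWithinAt γ s t :=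
    (hp.continuous.continuousAt.comp_continuousWithinAt hu.continuousWithinAt).congr_of_eventuallyEq
      hγ ht
  have hd : DifferentiableWithinAt ℝ (chartAt E (γ t) ∘ γ) s t :=
    (((hφ.restrict_scalars ℝ).differentiable (by simp)).differentiableAt.comp_differentiableWithinAt
      _ hu).congr_of_eventuallyEq h h'
  have hmd : MDifferentiableWithinAt 𝓘(ℝ, ℝ) 𝓘(ℝ, E) γ s t := by
    rw [mdifferentiableWithinAt_iff]
    refine ⟨hcont, ?_⟩
    simp only [mfld_simps]
    exact hd
  have h1 : (mfderivWithin 𝓘(ℝ, ℝ) 𝓘(ℝ, E) γ s t (1 : ℝ) : E) =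
      derivWithin (chartAt E (γ t) ∘ γ) s t := by
    rw [hmd.mfderivWithin]
    simp only [writtenInExtChartAt, mfld_simps]
    rfl
  have h2 := ((π.restrictScalars ℝ).hasFDerivAt.comp_hasDerivWithinAt t
    hd.hasDerivWithinAt).derivWithin hs
  rw [h1]
  refine Eq.trans (h2.symm) ?_
  have h3 : (π.restrictScalars ℝ) ∘ chartAt E (γ t) ∘ γ =ᶠ[𝓝[s] t] fun r => π (u r) + c := by
    filter_upwards [h] with r hr
    simp only [Function.comp_apply] at hr ⊢
    rw [hr]
    exact hc _
  rw [h3.derivWithin_eq ((congrArg π h').trans (hc _)), derivWithin_add_const]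
  rfl

/-- Since `p` inverts every preferred chart, `γ` read in the chart at `γ t` is a local lift. One
lift serves all `r` near `t`, although the velocity at `r` is taken in the chart at `γ r`. This
replaces global path lifting. -/
lemma exists_local_lift (hp : IsTranslationCovering π p)
    (hγ : ContMDiffOn 𝓘(ℝ, ℝ) 𝓘(ℝ, E) 1 γ s) (hs : UniqueDiffOn ℝ s)
    (ht : t ∈ s) :
    ∃ u : ℝ → E, ContDiffWithinAt ℝ 1 u s t ∧ ∀ᶠ r in 𝓝[s] t,
      γ r = p (u r) ∧ DifferentiableWithinAt ℝ (π ∘ u) s r ∧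
      π (mfderivWithin 𝓘(ℝ, ℝ) 𝓘(ℝ, E) γ s r (1 : ℝ) : E) = derivWithin (π ∘ u) s r := by
  refine ⟨chartAt E (γ t) ∘ γ,
    hp.chartAt_comp_contDiffWithinAt (hγ t ht) (mem_chart_source E (γ t)), ?_⟩
  have hev : ∀ᶠ r in 𝓝[s] t, γ r ∈ (chartAt E (γ t)).source :=
    (hγ.continuousOn t ht).eventually_mem (chart_source_mem_nhds E (γ t))
  filter_upwards [eventually_eventually_nhdsWithin.mpr hev, hev, self_mem_nhdsWithin]
    with r hr hr' hrs
  have hd := (hp.chartAt_comp_contDiffWithinAt (hγ r hrs) hr').differentiableWithinAt one_ne_zero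
  refine ⟨(hp.apply_chartAt hr').symm,
    (π.restrictScalars ℝ).differentiableAt.comp_differentiableWithinAt r hd,
    hp.map_mfderivWithin ?_ (hp.apply_chartAt hr').symm hd (hs r hrs)⟩
  filter_upwards [hr] with q hq
  exact (hp.apply_chartAt hq).symm

lemma continuousOn_velocity (hp : IsTranslationCovering π p)
    (hγ : ContMDiffOn 𝓘(ℝ, ℝ) 𝓘(ℝ, E) 1 γ s) (hs : UniqueDiffOn ℝ s) :
    ContinuousOn (fun r => π (mfderivWithin 𝓘(ℝ, ℝ) 𝓘(ℝ, E) γ s r (1 : ℝ) : E)) s := by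
  intro t ht
  obtain ⟨u, hu, hev⟩ := hp.exists_local_lift hγ hs ht
  have h1 : ContDiffWithinAt ℝ 1 (π ∘ u) s t :=
    (π.restrictScalars ℝ).contDiff.contDiffAt.comp_contDiffWithinAt t hu
  have h2 : ContinuousWithinAt (derivWithin (π ∘ u) s) s t := by
    have := (h1.fderivWithin_right (m := 0) hs (by simp) ht).continuousWithinAt
    exact this.clm_apply continuousWithinAt_const
  exact h2.congr_of_eventuallyEq (hev.mono fun r hr => hr.2.2) (hev.self_of_nhdsWithin ht).2.2

/-- The displacement of a `C¹` path, computed by integrating the `W`-component of its velocity,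
is the difference of the values at the end points of any map `X → W / Γ` induced by `π`. -/
lemma mk_integral_velocity (hp : IsTranslationCovering π p)
    [CompleteSpace W] {B : Type*} [AddCommGroup B] (f : W →+ B) (q : X → B)
    (hq : ∀ v, q (p v) = f (π v)) (hγ : IsC1Path E γ) :
    f (∫ r in (0 : ℝ)..1, π (mfderivWithin 𝓘(ℝ, ℝ) 𝓘(ℝ, E) γ (Icc 0 1) r (1 : ℝ) : E)) =
      q (γ 1) - q (γ 0) := by
  have hs : UniqueDiffOn ℝ (Icc (0 : ℝ) 1) := uniqueDiffOn_Icc zero_lt_one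
  set w : ℝ → W := fun r => π (mfderivWithin 𝓘(ℝ, ℝ) 𝓘(ℝ, E) γ (Icc 0 1) r (1 : ℝ) : E) with hw
  have hwc : ContinuousOn w (Icc 0 1) := hp.continuousOn_velocity hγ hs
  have hder : ∀ r ∈ Icc (0 : ℝ) 1,
      HasDerivWithinAt (fun r => ∫ x in (0 : ℝ)..r, w x) (w r) (Icc 0 1) r := by
    intro r hr
    have : Fact (r ∈ Icc (0 : ℝ) 1) := ⟨hr⟩
    refine intervalIntegral.integral_hasDerivWithinAt_right (s := Icc 0 1) (t := Icc 0 1) ?_ ?_ (hwc r hr)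
    · refine (hwc.mono ?_).intervalIntegrable
      rw [uIcc_of_le hr.1]
      exact Icc_subset_Icc_right hr.2
    · exact hwc.stronglyMeasurableAtFilter_nhdsWithin measurableSet_Icc r
  -- A local lift minus the primitive of the velocity has zero derivative on a convex neighbourhood.
  -- Applying `f` shows that this expression is locally constant, and `[0, 1]` is connected. No
  -- topology on `B` is needed.
  have hconst : ∀ x ∈ Icc (0 : ℝ) 1, ∀ y ∈ Icc (0 : ℝ) 1,
      q (γ x) - f (∫ r in (0 : ℝ)..x, w r) = q (γ y) - f (∫ r in (0 : ℝ)..y, w r) := by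
    intro x hx y hy
    refine isPreconnected_Icc.induction₂ (s := Icc (0 : ℝ) 1)
      (fun x y => q (γ x) - f (∫ r in (0 : ℝ)..x, w r) = q (γ y) - f (∫ r in (0 : ℝ)..y, w r))
      ?_ (fun _ _ _ _ _ _ h1 h2 => h1.trans h2) (fun _ _ _ _ h => h.symm) hx hy
    intro t ht
    obtain ⟨u, -, hev⟩ := hp.exists_local_lift hγ hs ht
    obtain ⟨ε, hε, hball⟩ := Metric.mem_nhdsWithin_iff.mp hev
    have hmem : Metric.ball t ε ∩ Icc 0 1 ∈ 𝓝[Icc 0 1] t := by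
      rw [inter_comm]; exact inter_mem_nhdsWithin _ (Metric.ball_mem_nhds t hε)
    filter_upwards [hmem] with r hr
    have htm : t ∈ Metric.ball t ε ∩ Icc 0 1 := ⟨Metric.mem_ball_self hε, ht⟩
    have hzero : ∀ z ∈ Metric.ball t ε ∩ Icc 0 1,
        HasDerivWithinAt (fun r => π (u r) - ∫ x in (0 : ℝ)..r, w x) 0
          (Metric.ball t ε ∩ Icc 0 1) z := by
      intro z hz
      obtain ⟨-, hd, heq⟩ := hball hz
      have h1 := hd.hasDerivWithinAt
      rw [← heq] at h1
      have h2 := (h1.sub (hder z hz.2)).mono (inter_subset_right (s := Metric.ball t ε))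
      rwa [sub_self] at h2
    have hcv : Convex ℝ (Metric.ball t ε ∩ Icc 0 1) := (convex_ball t ε).inter (convex_Icc 0 1)
    have hle := hcv.norm_image_sub_le_of_norm_hasDerivWithin_le (C := 0) hzero (by simp) htm hr
    have heq : π (u r) - π (u t) = (∫ x in (0 : ℝ)..r, w x) - ∫ x in (0 : ℝ)..t, w x := by
      have : (π (u r) - ∫ x in (0 : ℝ)..r, w x) - (π (u t) - ∫ x in (0 : ℝ)..t, w x) = 0 := by
        simpa using hle
      rw [← sub_eq_zero, ← this]; abel
    have := congrArg f heq
    rw [map_sub, map_sub] at this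
    rw [(hball hr).1, (hball htm).1, hq, hq, sub_eq_sub_iff_sub_eq_sub, ← neg_sub (f (π (u r))), this]
    abel
  have := hconst 0 (by simp) 1 (by simp)
  simp only [intervalIntegral.integral_same, map_zero, sub_zero] at this
  rw [this]
  abel

end IsTranslationCovering

end TranslationCovering

/-! ### Holomorphic one-forms on `X` as linear forms on `V₁` -/

namespace BagneraDeFranchis

variable {V₁ V₂ : Type*} [NormedAddCommGroup V₁] [NormedSpace ℂ V₁]
  [NormedAddCommGroup V₂] [NormedSpace ℂ V₂] [FiniteDimensional ℂ V₁] [FiniteDimensional ℂ V₂]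
  (D : BagneraDeFranchis V₁ V₂)

lemma isTranslationCovering_p :
    IsTranslationCovering (ContinuousLinearMap.fst ℂ V₁ V₂) D.p where
  continuous := D.continuous_p
  chartAt_symm_apply := D.chartAt_symm_apply
  chartAt_comp _ _ hv := D.chartAt_comp_p hv

/-- The value of a holomorphic one-form at `x`, in the preferred chart at `x`. -/
noncomputable def formAt (η : HolomorphicOneForm (V₁ × V₂) D.X) (x : D.X) : V₁ × V₂ →L[ℂ] ℂ := η x

/-- The pullback of a one-form on `X` to `V₁ × V₂`, as a function with values in the dual space. -/
noncomputable def pullback (η : HolomorphicOneForm (V₁ × V₂) D.X) (v : V₁ × V₂) :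
    V₁ × V₂ →L[ℂ] ℂ :=
  (D.formAt η (D.p v)).comp (D.derivP v)

lemma pullback_comp_fderiv (η : HolomorphicOneForm (V₁ × V₂) D.X) {φ : V₁ × V₂ → V₁ × V₂}
    (hφ : ∀ u, D.p (φ u) = D.p u) {v : V₁ × V₂} (hd : DifferentiableAt ℂ φ v) :
    (D.pullback η (φ v)).comp (fderiv ℂ φ v) = D.pullback η v := by
  -- The fibre in which `mfderiv` takes its values depends on the map, so `p ∘ φ = p` is used by
  -- substitution rather than by rewriting.
  have key : ∀ f : V₁ × V₂ → D.X, f = D.p →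
      (mfderiv 𝓘(ℂ, V₁ × V₂) 𝓘(ℂ, V₁ × V₂) f v : V₁ × V₂ →L[ℂ] V₁ × V₂) = D.derivP v := by
    rintro _ rfl; rfl
  have h : D.derivP v = (D.derivP (φ v)).comp (fderiv ℂ φ v) :=
    (key (D.p ∘ φ) (funext hφ)).symm.trans
      ((mfderiv_comp v (D.contMDiff_p.mdifferentiableAt (by simp)) hd.mdifferentiableAt).trans
        (by rw [mfderiv_eq_fderiv]; rfl))
  unfold pullback
  rw [ContinuousLinearMap.comp_assoc, ← h, hφ v]

lemma pullback_add (η : HolomorphicOneForm (V₁ × V₂) D.X) {w : V₁ × V₂} (h₁ : w.1 ∈ D.Λ₁)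
    (h₂ : w.2 ∈ D.Λ₂) (v : V₁ × V₂) : D.pullback η (v + w) = D.pullback η v := by
  have := D.pullback_comp_fderiv η (φ := fun u => u + w)
    (D.p_add_of_toA_eq_zero (D.toA_eq_zero_of_mem h₁ h₂)) (v := v) (by fun_prop)
  rw [← this]
  ext d <;> simp [fderiv_add_const]

/-- The function is the section `η` along `p` paired with the tangent map of `p` on the constant
vector field `d`; both are analytic as maps into total spaces. -/
lemma differentiable_pullback_apply (η : HolomorphicOneForm (V₁ × V₂) D.X) (d : V₁ × V₂) :
    Differentiable ℂ (fun v => D.pullback η v d) := by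
  rw [← mdifferentiable_iff_differentiable]
  have h1 : ContMDiff 𝓘(ℂ, V₁ × V₂) (𝓘(ℂ, V₁ × V₂).prod 𝓘(ℂ, V₁ × V₂)) ω
      (fun v => (⟨D.p v, mfderiv 𝓘(ℂ, V₁ × V₂) 𝓘(ℂ, V₁ × V₂) D.p v d⟩ :
        Bundle.TotalSpace (V₁ × V₂) (TangentSpace 𝓘(ℂ, V₁ × V₂) : D.X → Type _))) := by
    have ht := D.contMDiff_p.contMDiff_tangentMap (m := ω) (by simp)
    have hs : ContMDiff 𝓘(ℂ, V₁ × V₂) (𝓘(ℂ, V₁ × V₂).prod 𝓘(ℂ, V₁ × V₂)) ω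
        (fun v => (⟨v, d⟩ : TangentBundle 𝓘(ℂ, V₁ × V₂) (V₁ × V₂))) := by
      exact contMDiff_vectorSpace_iff_contDiff.mpr contDiff_const
    exact ht.comp hs
  have h2 : ContMDiff 𝓘(ℂ, V₁ × V₂) (𝓘(ℂ, V₁ × V₂).prod 𝓘(ℂ, V₁ × V₂ →L[ℂ] ℂ)) ω
      (fun v => (⟨D.p v, η (D.p v)⟩ : Bundle.TotalSpace (V₁ × V₂ →L[ℂ] ℂ)
        (fun x : D.X => TangentSpace 𝓘(ℂ, V₁ × V₂) x →L[ℂ] Bundle.Trivial D.X ℂ x))) :=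
    η.contMDiff.comp D.contMDiff_p
  have h3 := ContMDiff.clm_bundle_apply h2 h1
  intro v
  have h4 := (Bundle.contMDiffAt_totalSpace.mp (h3 v)).2
  exact h4.mdifferentiableAt (by simp)

/-- A change of charts is locally a deck transformation, which translates the first coordinate. -/
lemma fst_tangentCoordChange {x y z : D.X} (hx : z ∈ (chartAt (V₁ × V₂) x).source)
    (hy : z ∈ (chartAt (V₁ × V₂) y).source) (d : V₁ × V₂) :
    (tangentCoordChange 𝓘(ℂ, V₁ × V₂) x y z d).1 = d.1 := by
  obtain ⟨φ, c, hφ, hc, h⟩ := D.chartAt_comp_p (v := chartAt (V₁ × V₂) x z) (x := y)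
    (by rwa [D.p_chartAt hx])
  have h0 : ((chartAt (V₁ × V₂) x).symm : V₁ × V₂ → D.X) = D.p :=
    funext (D.chartAt_symm_apply x)
  have h1 : tangentCoordChange 𝓘(ℂ, V₁ × V₂) x y z = fderiv ℂ φ (chartAt (V₁ × V₂) x z) := by
    rw [tangentCoordChange_def]
    simp only [mfld_simps, fderivWithin_univ, h0]
    exact h.fderiv_eq
  have h2 := ((ContinuousLinearMap.fst ℂ V₁ V₂).hasFDerivAt.comp (chartAt (V₁ × V₂) x z)
    (hφ.differentiable (by simp) (chartAt (V₁ × V₂) x z)).hasFDerivAt)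
  have h3 : HasFDerivAt (ContinuousLinearMap.fst ℂ V₁ V₂ ∘ φ) (ContinuousLinearMap.fst ℂ V₁ V₂)
      (chartAt (V₁ × V₂) x z) := by
    have : ContinuousLinearMap.fst ℂ V₁ V₂ ∘ φ = fun u => ContinuousLinearMap.fst ℂ V₁ V₂ u + c :=
      funext hc
    rw [this]
    exact (ContinuousLinearMap.fst ℂ V₁ V₂).hasFDerivAt.add_const c
  rw [h1]
  exact congrArg (fun A : V₁ × V₂ →L[ℂ] V₁ => A d) (h2.unique h3)

/-- The holomorphic one-form on `X` induced by a linear form on `V₁`. -/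
noncomputable def constForm (ℓ : V₁ →L[ℂ] ℂ) : HolomorphicOneForm (V₁ × V₂) D.X where
  toFun _ := (ℓ.comp (ContinuousLinearMap.fst ℂ V₁ V₂) : V₁ × V₂ →L[ℂ] ℂ)
  contMDiff_toFun := by
    intro x₀
    rw [contMDiffAt_hom_bundle]
    refine ⟨contMDiffAt_id, ?_⟩
    -- In the trivialization at `x₀` the section is `ℓ ∘ fst` precomposed with a tangent coordinate
    -- change. Such a change preserves first components, so the local expression is constant.
    refine (contMDiffAt_const (c := ℓ.comp (ContinuousLinearMap.fst ℂ V₁ V₂))).congr_of_eventuallyEq ?_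
    filter_upwards [chart_source_mem_nhds (V₁ × V₂) x₀] with x hx
    refine (ContinuousLinearMap.inCoordinates_eq hx (mem_univ _)).trans ?_
    refine ContinuousLinearMap.ext fun d => ?_
    have h0 := congrFun (Bundle.Trivialization.symm_continuousLinearEquivAt_eq (R := ℂ)
      (trivializationAt (V₁ × V₂) (TangentSpace 𝓘(ℂ, V₁ × V₂)) x₀) hx) d
    have h := DFunLike.congr_fun (TangentBundle.symmL_trivializationAt_eq_core (I := 𝓘(ℂ, V₁ × V₂))
      (𝕜 := ℂ) hx) d
    change (trivializationAt ℂ (Bundle.Trivial D.X ℂ) x₀).continuousLinearEquivAt ℂ x (mem_univ _)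
      (ℓ (((trivializationAt (V₁ × V₂) (TangentSpace 𝓘(ℂ, V₁ × V₂)) x₀).continuousLinearEquivAt
        ℂ x hx).symm d : V₁ × V₂).1) = ℓ d.1
    refine (DFunLike.congr_fun
      (Bundle.Trivial.continuousLinearEquivAt_trivialization ℂ D.X ℂ x) _).trans ?_
    exact congrArg ℓ ((congrArg Prod.fst (h0.trans h)).trans
      (D.fst_tangentCoordChange hx (mem_chart_source _ x) d))

/-- Liouville on each torus factor in turn, moving first the `V₁`-coordinate and then the
`V₂`-coordinate. -/
lemma pullback_eq (η : HolomorphicOneForm (V₁ × V₂) D.X) (v w : V₁ × V₂) :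
    D.pullback η v = D.pullback η w := by
  refine ContinuousLinearMap.ext fun d => ?_
  have hd := D.differentiable_pullback_apply η d
  have h1 : D.pullback η v d = D.pullback η (w.1, v.2) d :=
    D.abelian₁.apply_eq_of_periodic (f := fun x => D.pullback η (x, v.2) d)
      (hd.comp (by fun_prop)) (fun z l hl => by
        have := D.pullback_add η (w := (l, 0)) hl (zero_mem _) (z, v.2)
        rw [← this]; simp) v.1 w.1
  have h2 : D.pullback η (w.1, v.2) d = D.pullback η w d :=
    D.abelian₂.apply_eq_of_periodic (f := fun y => D.pullback η (w.1, y) d)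
      (hd.comp (by fun_prop)) (fun z l hl => by
        have := D.pullback_add η (w := (0, l)) (zero_mem _) hl (w.1, z)
        rw [← this]; simp) v.2 w.2
  exact h1.trans h2

/-- At the point of `V₁ × V₂` given by the chart at `x`, that chart inverts `p`, so `derivP` is the
identity there. -/
lemma formAt_eq_pullback (η : HolomorphicOneForm (V₁ × V₂) D.X) (x : D.X) :
    D.formAt η x = D.pullback η (chartAt (V₁ × V₂) x x) := by
  have hx := mem_chart_source (V₁ × V₂) x
  obtain ⟨v, hv, hvx⟩ : ∃ v, v ∈ (chartAt (V₁ × V₂) x).target ∧ D.p v = x :=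
    ⟨chartAt (V₁ × V₂) x x, (chartAt (V₁ × V₂) x).map_source hx, D.p_chartAt hx⟩
  subst hvx
  have hid : chartAt (V₁ × V₂) (D.p v) ∘ D.p =ᶠ[𝓝 v] id := by
    filter_upwards [(chartAt (V₁ × V₂) (D.p v)).open_target.mem_nhds hv] with u hu
    rw [Function.comp_apply, ← D.chartAt_symm_apply (D.p v) u, OpenPartialHomeomorph.right_inv _ hu]
    rfl
  have h := D.derivP_of_eventuallyEq hid
  rw [D.pullback_eq η _ v]
  unfold pullback
  rw [h, fderiv_id]
  rfl

/-- A holomorphic one-form on `X` is invariant under `α₂`, hence vanishes on `V₂`. -/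
lemma pullback_apply_snd (η : HolomorphicOneForm (V₁ × V₂) D.X) (v : V₁ × V₂) (d : V₂) :
    D.pullback η v (0, d) = 0 := by
  obtain ⟨b, hb⟩ := QuotientAddGroup.mk_surjective D.β₁
  obtain ⟨d, rfl⟩ := D.surjective_α₂_sub_id d
  have hφ : HasFDerivAt (fun u : V₁ × V₂ => (u.1 + b, D.α₂ u.2))
      ((ContinuousLinearMap.fst ℂ V₁ V₂).prod
        ((D.α₂ : V₂ →L[ℂ] V₂).comp (ContinuousLinearMap.snd ℂ V₁ V₂))) v :=
    (hasFDerivAt_fst.add_const b).prodMk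
      ((D.α₂ : V₂ →L[ℂ] V₂).hasFDerivAt.comp v hasFDerivAt_snd)
  have h := D.pullback_comp_fderiv η (D.p_translate hb) hφ.differentiableAt
  rw [hφ.fderiv, D.pullback_eq η _ v] at h
  have h' := DFunLike.congr_fun h ((0, d) : V₁ × V₂)
  have hsub : ((0, D.α₂ d - d) : V₁ × V₂) = (0, D.α₂ d) - (0, d) := by simp
  rw [hsub, map_sub, sub_eq_zero]
  exact h'

lemma constForm_bijective : Function.Bijective D.constForm := by
  constructor
  · intro ℓ ℓ' h
    obtain ⟨x⟩ : Nonempty D.X := ⟨D.p 0⟩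
    refine ContinuousLinearMap.ext fun v => ?_
    exact congrArg (fun η => D.formAt η x (v, 0)) h
  · intro η
    refine ⟨(D.pullback η 0).comp (ContinuousLinearMap.inl ℂ V₁ V₂), ?_⟩
    refine ContMDiffSection.ext fun x => ?_
    change (_ : V₁ × V₂ →L[ℂ] ℂ) = D.formAt η x
    rw [D.formAt_eq_pullback, D.pullback_eq η (chartAt (V₁ × V₂) x x) 0]
    refine ContinuousLinearMap.ext fun (d : V₁ × V₂) => ?_
    change D.pullback η 0 (d.1, 0) = D.pullback η 0 d
    have hd : d = (d.1, 0) + (0, d.2) := by simp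
    conv_rhs => rw [hd, map_add, D.pullback_apply_snd, add_zero]

/-- The linear isomorphism between linear forms on `V₁` and holomorphic one-forms on `X`. -/
noncomputable def formEquiv : Module.Dual ℂ V₁ ≃ₗ[ℂ] HolomorphicOneForm (V₁ × V₂) D.X :=
  LinearMap.toContinuousLinearMap.trans
    (LinearEquiv.ofBijective
      { toFun := D.constForm
        map_add' := fun _ _ => ContMDiffSection.ext fun _ => rfl
        map_smul' := fun _ _ => ContMDiffSection.ext fun _ => rfl } D.constForm_bijective)

/-- The linear isomorphism from `V₁` to the dual of the space of holomorphic one-forms on `X`. -/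
noncomputable def dualEquiv : V₁ ≃ₗ[ℂ] Module.Dual ℂ (HolomorphicOneForm (V₁ × V₂) D.X) :=
  (Module.evalEquiv ℂ V₁).trans D.formEquiv.symm.dualMap

lemma dualEquiv_formEquiv (v : V₁) (ℓ : Module.Dual ℂ V₁) :
    D.dualEquiv v (D.formEquiv ℓ) = ℓ v := by
  simp [dualEquiv]

/-! ### Periods and the Albanese map -/

/-- The `V₁`-component of the velocity of a path in `X`. -/
noncomputable def velocity (γ : ℝ → D.X) (t : ℝ) : V₁ :=
  ContinuousLinearMap.fst ℂ V₁ V₂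
    -- The real structure is restricted from the complex one on the product, as in `IsC1Path` and
    -- `HolomorphicOneForm.integral`, and is not the product of the real structures on the factors.
    (@mfderivWithin ℝ _ ℝ _ _ ℝ _ 𝓘(ℝ, ℝ) ℝ _ _ (V₁ × V₂) _ NormedSpace.complexToReal _ _
      (@modelWithCornersSelf ℝ _ (V₁ × V₂) _ NormedSpace.complexToReal) D.X _ _ γ (Icc 0 1) t
      (1 : ℝ) : V₁ × V₂)

lemma integral_eq {γ : ℝ → D.X} (hγ : IsC1Path (V₁ × V₂) γ)
    (η : HolomorphicOneForm (V₁ × V₂) D.X) :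
    η.integral γ = D.dualEquiv (∫ t in (0 : ℝ)..1, D.velocity γ t) η := by
  obtain ⟨ℓ, rfl⟩ := D.formEquiv.surjective η
  rw [dualEquiv_formEquiv]
  have hc : ContinuousOn (D.velocity γ) (Icc 0 1) :=
    D.isTranslationCovering_p.continuousOn_velocity hγ (uniqueDiffOn_Icc zero_lt_one)
  have hi : IntervalIntegrable (D.velocity γ) MeasureTheory.volume 0 1 := by
    refine ContinuousOn.intervalIntegrable ?_
    rwa [uIcc_of_le zero_le_one]
  exact (LinearMap.toContinuousLinearMap ℓ).intervalIntegral_comp_comm hi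

lemma toB_integral_velocity {γ : ℝ → D.X} (hγ : IsC1Path (V₁ × V₂) γ) :
    D.toB (∫ t in (0 : ℝ)..1, D.velocity γ t) = D.XtoB (γ 1) - D.XtoB (γ 0) :=
  D.isTranslationCovering_p.mk_integral_velocity D.toB D.XtoB D.XtoB_p hγ

/-- The periods of `X` are the images of the vectors of `V₁` lying over `T₁ + ⟨β₁⟩`. -/
lemma mem_periodGroup_iff (v : V₁) :
    D.dualEquiv v ∈ periodGroup (V₁ × V₂) D.X ↔ D.toB v = 0 := by
  constructor
  -- The image of the kernel of `toB` is a subgroup, so it is enough to treat the generators, which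
  -- are integrals along single loops.
  · have hle : periodGroup (V₁ × V₂) D.X ≤
        D.toB.ker.map (D.dualEquiv.toAddEquiv : V₁ →+ _) := by
      refine (AddSubgroup.closure_le _).mpr ?_
      rintro φ ⟨γ, hγ, hloop, hφ⟩
      refine ⟨∫ t in (0 : ℝ)..1, D.velocity γ t, ?_, ?_⟩
      · change D.toB _ = 0
        rw [D.toB_integral_velocity hγ, hloop, sub_self]
      · refine LinearMap.ext fun η => ?_
        rw [hφ, D.integral_eq hγ]
        rfl
    intro h
    obtain ⟨v', hv', heq⟩ := hle h
    obtain rfl : v' = v := D.dualEquiv.injective heq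
    exact hv'
  · intro hv
    obtain ⟨w, hw⟩ := D.exists_p_eq_p_zero hv
    -- The segment from `0` to `(v, w)` maps to a loop in `X` with constant `V₁`-velocity `v`, so
    -- its period is `v` itself.
    let u : ℝ → V₁ × V₂ := fun t => t • (v, w)
    have hu : ContDiff ℝ 1 u := by fun_prop
    have hγ : IsC1Path (V₁ × V₂) (D.p ∘ u) := fun t _ =>
      D.isTranslationCovering_p.contMDiffWithinAt_comp hu.contDiffWithinAt
    refine AddSubgroup.subset_closure ⟨D.p ∘ u, hγ, ?_, fun η => ?_⟩
    · change D.p ((0 : ℝ) • (v, w)) = D.p ((1 : ℝ) • (v, w))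
      rw [zero_smul, one_smul, hw]
    · rw [D.integral_eq hγ]
      have hvel : ∀ t ∈ uIcc (0 : ℝ) 1, D.velocity (D.p ∘ u) t = v := by
        intro t ht
        rw [uIcc_of_le zero_le_one] at ht
        have h1 := uniqueDiffOn_Icc (zero_lt_one (α := ℝ)) t ht
        refine (D.isTranslationCovering_p.map_mfderivWithin (γ := D.p ∘ u) (.refl _ _) rfl
          (hu.differentiable one_ne_zero t).differentiableWithinAt h1).trans ?_
        have h2 : HasDerivAt (fun t : ℝ => t • v) v t := by
          simpa using (hasDerivAt_id t).smul_const v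
        exact h2.hasDerivWithinAt.derivWithin h1
      rw [intervalIntegral.integral_congr hvel]
      simp

/-- The map `V₁ → Alb(X)` induced by `dualEquiv`. -/
noncomputable def toAlbanese : V₁ →+ Albanese (V₁ × V₂) D.X :=
  (QuotientAddGroup.mk' (periodGroup (V₁ × V₂) D.X)).comp
    (D.dualEquiv.toAddEquiv : V₁ →+ Module.Dual ℂ (HolomorphicOneForm (V₁ × V₂) D.X))

lemma toAlbanese_surjective : Function.Surjective D.toAlbanese :=
  (QuotientAddGroup.mk'_surjective _).comp D.dualEquiv.surjective

lemma ker_toB_eq_ker_toAlbanese : D.toB.ker = D.toAlbanese.ker := by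
  ext v
  exact (D.mem_periodGroup_iff v).symm.trans (QuotientAddGroup.eq_zero_iff _).symm

/-- The isomorphism `A₁ / (T₁ + ⟨β₁⟩) ≃ Alb(X)`. -/
noncomputable def albaneseEquiv : D.B ≃+ Albanese (V₁ × V₂) D.X :=
  (QuotientAddGroup.quotientKerEquivOfSurjective D.toB D.toB_surjective).symm.trans
    ((QuotientAddGroup.quotientAddEquivOfEq D.ker_toB_eq_ker_toAlbanese).trans
      (QuotientAddGroup.quotientKerEquivOfSurjective D.toAlbanese D.toAlbanese_surjective))

lemma albaneseEquiv_toB (v : V₁) : D.albaneseEquiv (D.toB v) = D.toAlbanese v := by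
  have h : (QuotientAddGroup.quotientKerEquivOfSurjective D.toB D.toB_surjective).symm (D.toB v) =
      (v : V₁ ⧸ D.toB.ker) :=
    (AddEquiv.symm_apply_eq _).mpr rfl
  unfold albaneseEquiv
  rw [AddEquiv.trans_apply, h]
  rfl

end BagneraDeFranchis

/-- The Albanese variety of `X = A / G`, `A = (A₁ × A₂) / T`, is `A₁ / (T₁ + ⟨β₁⟩)`: there is a group
isomorphism `e` which lifts to a `ℂ`-linear isomorphism `F` of the universal covers (so it is an
isomorphism of complex tori), and under it the map `X → A₁ / (T₁ + ⟨β₁⟩)` induced by the first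
projection becomes the Albanese map, for every base point. -/
theorem mainTheorem9 {V₁ V₂ : Type*}
    [NormedAddCommGroup V₁] [NormedSpace ℂ V₁] [FiniteDimensional ℂ V₁]
    [NormedAddCommGroup V₂] [NormedSpace ℂ V₂] [FiniteDimensional ℂ V₂]
    (D : BagneraDeFranchis V₁ V₂) :
    ∃ (F : V₁ ≃ₗ[ℂ] Module.Dual ℂ (HolomorphicOneForm (V₁ × V₂) D.X))
      (e : D.A₁ ⧸ (D.T₁ ⊔ AddSubgroup.zmultiples D.β₁) ≃+ Albanese (V₁ × V₂) D.X),
      (∀ v : V₁, e ((v : D.A₁) : D.A₁ ⧸ (D.T₁ ⊔ AddSubgroup.zmultiples D.β₁)) =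
        (F v : Albanese (V₁ × V₂) D.X)) ∧
      ∀ x₀ : D.X, IsAlbaneseMap (V₁ × V₂) x₀ (fun x => e (D.XtoB x - D.XtoB x₀)) := by
  refine ⟨D.dualEquiv, D.albaneseEquiv, D.albaneseEquiv_toB, fun x₀ γ hγ h0 => ?_⟩
  refine ⟨D.dualEquiv (∫ t in (0 : ℝ)..1, D.velocity γ t),
    fun η => (D.integral_eq hγ η).symm, ?_⟩
  change D.albaneseEquiv (D.XtoB (γ 1) - D.XtoB x₀) = _
  rw [← h0, ← D.toB_integral_velocity hγ, D.albaneseEquiv_toB]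
  rfl
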